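/- Let $S$ be a topological monoid acting continuously (by a monoid action) on a topological space $X$. A proper $S$-compactification of $X$ is an $S$-equivariant topological embedding $\nu\colon X\hookrightarrow Y$ with dense image into a compact Hausdorff space $Y$ with a continuous action of $S$. Write $w$ for the weight (the least cardinality of a base) and $\dim$ for the covering dimension, with $\dim\emptyset=-1$. Let $\nu\colon X\hookrightarrow Y$ be a proper $S$-compactification of $X$. Then there exist a proper $S$-compactification $\sigma\colon X\hookrightarrow K$ and a continuous $S$-equivariant map $q\colon Y\to K$ with $\sigma=q\circ\nu$ (that is, $\sigma$ is majored by $\nu$) such that $$w(X)\le w(K)\le w(X)\cdot w(S)\quad\text{and}\quad \dim K\le\dim Y.$$ In particular, if $\dim Y=0$ then $\dim K=0$, and if $Y$ is a Stone space (compact Hausdorff with a base of clopen sets) then so is $K$. Moreover, if $w(S)\le w(X)$, or if $S$ is second countable, then $w(K)=w(X)$. -/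

import Mathlib

universe u v w

/-- The weight `w(X)` of a topological space: the least cardinality of a base. -/
noncomputable def topWeight (X : Type u) [TopologicalSpace X] : Cardinal.{u} :=
  sInf {c | ∃ B : Set (Set X), TopologicalSpace.IsTopologicalBasis B ∧ Cardinal.mk B = c}

/-- The order of a family `P` of subsets of `X`: the supremum over all points `x` of the number
of members of `P` that contain `x`. -/
noncomputable def coverOrder {X : Type u} (P : Set (Set X)) : ℕ∞ :=
  ⨆ x : X, {A ∈ P | x ∈ A}.encard

/-- `P` is a finite open covering of `X`. -/
def IsFiniteOpenCover {X : Type u} [TopologicalSpace X] (P : Set (Set X)) : Prop :=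
  P.Finite ∧ (∀ A ∈ P, IsOpen A) ∧ ⋃₀ P = Set.univ

/-- `dim X ≤ n`, for a natural number `n`: every finite open covering has a finite open
refinement of order at most `n + 1`. -/
def CoveringDimLE (X : Type u) [TopologicalSpace X] (n : ℕ) : Prop :=
  ∀ P : Set (Set X), IsFiniteOpenCover P →
    ∃ Q : Set (Set X), IsFiniteOpenCover Q ∧ (∀ A ∈ Q, ∃ B ∈ P, A ⊆ B) ∧
      coverOrder Q ≤ (n : ℕ∞) + 1

open scoped Classical in
/-- The covering dimension `dim X`: `⊥` (in the role of `-1`) for the empty space, and otherwise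
the least `n` with `dim X ≤ n`, or `⊤` (infinity) if there is none. -/
noncomputable def coveringDim (X : Type u) [TopologicalSpace X] : WithBot ℕ∞ :=
  if IsEmpty X then ⊥
  else ((⨅ (n : ℕ) (_ : CoveringDimLE X n), (n : ℕ∞) : ℕ∞) : WithBot ℕ∞)

/-- A Stone space: a compact (Hausdorff) space with a base of clopen sets. -/
structure IsStoneSpace (X : Type u) [TopologicalSpace X] : Prop where
  compactSpace : CompactSpace X
  t2Space : T2Space X
  clopenBasis : TopologicalSpace.IsTopologicalBasis {A : Set X | IsClopen A}

/-- `ν : X → K` is a proper `S`-compactification of the `S`-space `X`: `K` is a compact Hausdorff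
`S`-space and `ν` is an equivariant topological embedding with dense image. -/
structure IsProperSCompactification (S : Type v) [Monoid S] [TopologicalSpace S]
    {X : Type u} [TopologicalSpace X] [MulAction S X]
    {K : Type w} [TopologicalSpace K] [MulAction S K] (ν : X → K) : Prop where
  compactSpace : CompactSpace K
  t2Space : T2Space K
  continuousSMul : ContinuousSMul S K
  map_smul : ∀ (s : S) (x : X), ν (s • x) = s • ν x
  denseRange : DenseRange ν
  isEmbedding : Topology.IsEmbedding ν

/-!
The space `K` is a quotient of `Y`, obtained from a small algebra of functions on `Y`.

If `X` is finite, then `ν` is onto and `K = Y` works. Let `X` be infinite and `κ = w(X) · w(S)`, an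
infinite cardinal. The quotient of `Y` that identifies the points which a family `F ⊆ C(Y, ℝ)` does
not separate has the required properties as soon as `F` has at most `κ` members and

* `F` contains enough functions to separate the points of `X` from its closed subsets, so that `X`
  remains embedded; `w(X)` functions suffice (`exists_family_separating_points_from_closed`);
* `F` is stable under precomposition with the elements of a dense subset of `S`; then the
  equivalence relation is `S`-invariant, and the action on the quotient is continuous because
  `S × Y → S × K` is a proper surjection (`exists_mulAction_of_surjective`);
* `F` is a `ℚ`-subalgebra; by the Stone–Weierstrass theorem (`dense_of_separatesPoints_rat`) it is
  dense in `C(K, ℝ)`, so that the sets `{f > 1/2}` with `f ∈ F` form a base of `K` and every finite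
  open cover of `K` has a refinement by finitely many of them (`exists_superlevel_shrinking`);
* whenever finitely many sets `{f > 1/2}` with `f ∈ F` cover `Y`, and `dim Y ≤ n`, they are refined
  by a cover of order at most `n + 1` by sets of the same kind; then `dim K ≤ n`.

All these are closure conditions under operations that assign at most `κ` functions to finitely many
given ones, so that a family `F` of cardinality at most `κ` satisfies them all
(`exists_superset_forall_finset_subset`). This proves a Mardešić-type factorization theorem
(`exists_quotient_topWeight_le`). The assertion on Stone spaces follows, since a compact Hausdorff
space is a Stone space if and only if its dimension is at most `0`
(`IsStoneSpace.coveringDimLE_zero`, `CoveringDimLE.isStoneSpace`).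
-/

open Cardinal Topology TopologicalSpace Set

/-! ### Weight -/

theorem exists_isTopologicalBasis_mk_eq_topWeight (X : Type u) [TopologicalSpace X] :
    ∃ B : Set (Set X), IsTopologicalBasis B ∧ #B = topWeight X :=
  csInf_mem (s := {c | ∃ B : Set (Set X), IsTopologicalBasis B ∧ #B = c})
    ⟨_, _, isTopologicalBasis_opens, rfl⟩

theorem topWeight_le_mk {X : Type u} [TopologicalSpace X] {B : Set (Set X)}
    (hB : IsTopologicalBasis B) : topWeight X ≤ #B :=
  csInf_le' ⟨B, hB, rfl⟩

theorem lift_topWeight_le_of_isInducing {X : Type u} {K : Type w} [TopologicalSpace X]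
    [TopologicalSpace K] {f : X → K} (hf : IsInducing f) :
    lift.{w} (topWeight X) ≤ lift.{u} (topWeight K) := by
  obtain ⟨B, hB, hc⟩ := exists_isTopologicalBasis_mk_eq_topWeight K
  rw [← hc]
  exact (lift_le.2 (topWeight_le_mk (hB.isInducing hf))).trans mk_image_le_lift

theorem aleph0_le_topWeight (X : Type u) [TopologicalSpace X] [T0Space X] [Infinite X] :
    ℵ₀ ≤ topWeight X := by
  obtain ⟨B, hB, hc⟩ := exists_isTopologicalBasis_mk_eq_topWeight X
  rw [← hc, ← not_lt, lt_aleph0_iff_finite]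
  intro h
  -- In a `T₀` space a point is determined by the basic sets that contain it.
  have hinj : Function.Injective fun x : X => {A : B | x ∈ A.1} := by
    intro x y hxy
    refine (hB.inseparable_iff.2 fun s hs => ?_).eq
    exact Set.ext_iff.1 hxy ⟨s, hs⟩
  exact not_finite_iff_infinite.2 ‹Infinite X› (Finite.of_injective _ hinj)

theorem exists_dense_mk_le_topWeight (X : Type u) [TopologicalSpace X] :
    ∃ D : Set X, Dense D ∧ #D ≤ topWeight X := by
  classical
  obtain ⟨B, hB, hc⟩ := exists_isTopologicalBasis_mk_eq_topWeight X
  let N : Set B := {A | A.1.Nonempty}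
  refine ⟨range fun A : N => A.2.some, hB.dense_iff.2 fun o ho hne => ?_, ?_⟩
  · exact ⟨_, (⟨⟨o, ho⟩, hne⟩ : N).2.some_mem, mem_range_self _⟩
  · rw [← hc]
    exact mk_range_le.trans (mk_set_le N)

theorem topWeight_ne_zero (X : Type u) [TopologicalSpace X] [Nonempty X] : topWeight X ≠ 0 := by
  obtain ⟨B, hB, hc⟩ := exists_isTopologicalBasis_mk_eq_topWeight X
  obtain ⟨A, hA, -⟩ := hB.exists_subset_of_mem_open (mem_univ (Classical.arbitrary X)) isOpen_univ
  rw [← hc]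
  exact mk_ne_zero_iff.2 ⟨⟨A, hA⟩⟩

theorem topWeight_le_aleph0 (X : Type u) [TopologicalSpace X] [SecondCountableTopology X] :
    topWeight X ≤ ℵ₀ :=
  (topWeight_le_mk (isBasis_countableBasis X)).trans
    (le_aleph0_iff_set_countable.2 (countable_countableBasis X))

/-! ### Closing a set under finitary operations -/

/-- If an operation `T` assigns to every finite set at most `κ` points, with `κ` infinite, then every
set of at most `κ` points lies in a `T`-closed set of at most `κ` points. -/
theorem exists_superset_forall_finset_subset {α : Type w} {κ : Cardinal.{w}} (hκ : ℵ₀ ≤ κ)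
    {A : Set α} (hA : #A ≤ κ) (T : Finset α → Set α) (hT : ∀ l, #(T l) ≤ κ) :
    ∃ F : Set α, A ⊆ F ∧ #F ≤ κ ∧ ∀ l : Finset α, (l : Set α) ⊆ F → T l ⊆ F := by
  classical
  let step (G : Set α) : Set α :=
    G ∪ ⋃ l : Finset G, T (l.map (Function.Embedding.subtype (· ∈ G)))
  have hstep (G : Set α) (hG : #G ≤ κ) : #(step G) ≤ κ := by
    refine (mk_union_le _ _).trans (add_le_of_le hκ hG ?_)
    refine (mk_iUnion_le _).trans (mul_le_of_le hκ ?_ (ciSup_le' fun l => hT _))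
    refine (mk_le_of_surjective (f := fun l : List G => l.toFinset) fun s => ?_).trans
      ((mk_list_le_max _).trans (max_le hκ hG))
    exact ⟨s.toList, by simp⟩
  let G (n : ℕ) : Set α := step^[n] A
  have hsucc (n : ℕ) : G (n + 1) = step (G n) := Function.iterate_succ_apply' _ _ _
  have hmono : Monotone G := monotone_nat_of_le_succ fun n => by
    rw [hsucc]; exact subset_union_left
  have hcard (n : ℕ) : #(G n) ≤ κ := by
    induction n with
    | zero => exact hA
    | succ n ih => rw [hsucc]; exact hstep _ ih
  refine ⟨⋃ n, G n, subset_iUnion G 0, ?_, fun l hl => ?_⟩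
  · have h := mk_iUnion_le_lift G
    rw [lift_uzero, mk_nat, lift_aleph0] at h
    refine h.trans (mul_le_of_le hκ hκ (ciSup_le' fun n => ?_))
    rw [lift_uzero]
    exact hcard n
  · obtain ⟨n, hn⟩ : ∃ n, (l : Set α) ⊆ G n := by
      have h : ∀ x ∈ l, ∃ n, x ∈ G n := fun x hx => mem_iUnion.1 (hl hx)
      choose! N hN using h
      exact ⟨l.sup N, fun x hx => hmono (Finset.le_sup hx) (hN x hx)⟩
    refine Subset.trans ?_ (subset_iUnion G (n + 1))
    rw [hsucc]
    refine Subset.trans ?_ subset_union_right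
    refine Subset.trans (Eq.subset ?_)
      (subset_iUnion _ (l.subtype (· ∈ G n)))
    rw [Finset.subtype_map_of_mem hn]

/-! ### Superlevel sets of continuous functions -/

/-- The open set `{f > 1/2}`. The threshold `1/2` leaves room for a uniform approximation of a
Urysohn function that takes the values `0` and `1`. -/
def superlevel {X : Type u} [TopologicalSpace X] (f : C(X, ℝ)) : Set X := {x | 1 / 2 < f x}

theorem isOpen_superlevel {X : Type u} [TopologicalSpace X] (f : C(X, ℝ)) :
    IsOpen (superlevel f) :=
  isOpen_lt continuous_const f.continuous

theorem exists_mem_superlevel_between {X : Type u} [TopologicalSpace X] [CompactSpace X] [T2Space X]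
    {F : Set C(X, ℝ)} (hF : Dense F) {C U : Set X} (hC : IsClosed C) (hU : IsOpen U)
    (hCU : C ⊆ U) : ∃ f ∈ F, C ⊆ superlevel f ∧ superlevel f ⊆ U := by
  obtain ⟨h, h0, h1, -⟩ := exists_continuous_zero_one_of_isClosed hU.isClosed_compl hC
    (disjoint_compl_left_iff_subset.2 hCU)
  obtain ⟨f, hf, hd⟩ := hF.exists_dist_lt h (ε := 1 / 2) (by norm_num)
  have hd' (x : X) : |h x - f x| < 1 / 2 :=
    (ContinuousMap.dist_apply_le_dist x).trans_lt hd
  refine ⟨f, hf, fun x hx => ?_, fun x hx => ?_⟩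
  · have := (abs_lt.1 (hd' x)).2
    rw [h1 hx] at this
    simp only [superlevel, mem_ofPred_eq]
    simp only [Pi.one_apply] at this
    linarith
  · by_contra hxU
    have := (abs_lt.1 (hd' x)).1
    rw [h0 hxU] at this
    simp only [superlevel, mem_ofPred_eq] at hx
    simp only [Pi.zero_apply] at this
    linarith

/-- A finite open cover of a compact Hausdorff space shrinks to a cover by superlevel sets of functions
taken from any prescribed dense set, one function for each member of the cover. -/
theorem exists_superlevel_shrinking {X : Type u} [TopologicalSpace X] [CompactSpace X] [T2Space X]
    {F : Set C(X, ℝ)} (hF : Dense F) {P : Set (Set X)} (hP : IsFiniteOpenCover P) :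
    ∃ f : Set X → C(X, ℝ), (∀ A ∈ P, f A ∈ F ∧ superlevel (f A) ⊆ A) ∧
      ∀ x, ∃ A ∈ P, x ∈ superlevel (f A) := by
  obtain ⟨hfin, hopen, hcov⟩ := hP
  have : Finite P := hfin
  obtain ⟨C, hCcov, hC, hCsub⟩ := exists_iUnion_eq_closed_subset (u := fun A : P => A.1)
    (fun A => hopen _ A.2) (fun _ => toFinite _) (by rw [← sUnion_eq_iUnion, hcov])
  have key : ∀ A : Set X, ∃ f : C(X, ℝ), ∀ hA : A ∈ P,
      f ∈ F ∧ C ⟨A, hA⟩ ⊆ superlevel f ∧ superlevel f ⊆ A := by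
    intro A
    by_cases hA : A ∈ P
    · obtain ⟨f, hf⟩ := exists_mem_superlevel_between hF (hC ⟨A, hA⟩) (hopen A hA) (hCsub ⟨A, hA⟩)
      exact ⟨f, fun _ => hf⟩
    · exact ⟨0, fun h => (hA h).elim⟩
  choose f hf using key
  refine ⟨f, fun A hA => ⟨(hf A hA).1, (hf A hA).2.2⟩, fun x => ?_⟩
  obtain ⟨A, hA⟩ := mem_iUnion.1 (hCcov.symm.subset (mem_univ x))
  exact ⟨A, A.2, (hf A A.2).2.1 hA⟩

/-- The superlevel sets of a dense set of functions form a base. -/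
theorem topWeight_le_mk_of_dense {X : Type u} [TopologicalSpace X] [CompactSpace X] [T2Space X]
    {F : Set C(X, ℝ)} (hF : Dense F) : topWeight X ≤ #F := by
  refine (topWeight_le_mk (B := superlevel '' F) ?_).trans mk_image_le
  refine isTopologicalBasis_of_isOpen_of_nhds ?_ fun x U hx hU => ?_
  · rintro _ ⟨f, -, rfl⟩
    exact isOpen_superlevel f
  · obtain ⟨f, hf, hxf, hfU⟩ := exists_mem_superlevel_between hF isClosed_singleton hU
      (singleton_subset_iff.2 hx)
    exact ⟨_, mem_image_of_mem _ hf, hxf rfl, hfU⟩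

/-- The Stone–Weierstrass theorem over `ℚ`. -/
theorem dense_of_separatesPoints_rat {X : Type u} [TopologicalSpace X] [CompactSpace X]
    (F : Subalgebra ℚ C(X, ℝ)) (hF : ∀ x y, (∀ f ∈ F, f x = f y) → x = y) :
    Dense (F : Set C(X, ℝ)) := by
  -- The closure of `F` is an algebra over `ℝ`, because real constants are limits of rational ones.
  have hreal (r : ℝ) : algebraMap ℝ C(X, ℝ) r ∈ F.toSubring.topologicalClosure := by
    refine map_mem_closure (f := algebraMap ℝ C(X, ℝ)) (ContinuousMap.continuous_const')
      (Rat.isDenseEmbedding_coe_real.dense r) ?_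
    rintro _ ⟨c, rfl⟩
    have : algebraMap ℝ C(X, ℝ) (c : ℝ) = algebraMap ℚ C(X, ℝ) c := by
      ext x; simp
    rw [this]
    exact F.algebraMap_mem c
  let R : Subalgebra ℝ C(X, ℝ) :=
    { F.toSubring.topologicalClosure with algebraMap_mem' := hreal }
  have hFR : (F : Set C(X, ℝ)) ⊆ R := F.toSubring.le_topologicalClosure
  have htop := ContinuousMap.subalgebra_topologicalClosure_eq_top_of_separatesPoints R (by
    intro x y hxy
    by_contra! h
    refine hxy (hF x y fun f hf => h _ ⟨f, hFR hf, rfl⟩))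
  intro f
  have hf : f ∈ R.topologicalClosure := htop ▸ Algebra.mem_top
  have hR : (R : Set C(X, ℝ)) = closure (F : Set C(X, ℝ)) := rfl
  have hf' : f ∈ closure (R : Set C(X, ℝ)) := hf
  rwa [hR, closure_closure] at hf'

/-! ### Covering dimension -/

theorem coverOrder_image_le {X : Type u} {P : Set (Set X)} {s : Set X → Set X}
    (hs : ∀ A ∈ P, s A ⊆ A) : coverOrder (s '' P) ≤ coverOrder P := by
  refine iSup_le fun x => le_trans ?_ (le_iSup _ x)
  refine le_trans (encard_le_encard ?_) (encard_image_le s _)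
  rintro _ ⟨⟨A, hA, rfl⟩, hx⟩
  exact ⟨A, ⟨hA, hs A hA hx⟩, rfl⟩

/-- The preimages of distinct sets under a surjection are distinct, so that the order of a family
does not drop. -/
theorem coverOrder_le_preimage {X : Type u} {K : Type w} {q : X → K} (hq : Function.Surjective q)
    (P : Set (Set K)) : coverOrder P ≤ coverOrder (preimage q '' P) := by
  refine iSup_le fun k => ?_
  obtain ⟨x, rfl⟩ := hq k
  refine le_trans ?_ (le_iSup _ x)
  rw [← hq.preimage_injective.encard_image]
  refine encard_le_encard ?_
  rintro _ ⟨A, ⟨hA, hx⟩, rfl⟩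
  exact ⟨⟨A, hA, rfl⟩, hx⟩

theorem coveringDim_le_of_forall {X : Type u} {K : Type w} [TopologicalSpace X]
    [TopologicalSpace K] (hne : IsEmpty X → IsEmpty K)
    (h : ∀ n, CoveringDimLE X n → CoveringDimLE K n) : coveringDim K ≤ coveringDim X := by
  unfold coveringDim
  by_cases hX : IsEmpty X
  · simp [hX, hne hX]
  · by_cases hK : IsEmpty K
    · simp [hK]
    · simp only [hX, hK, if_false]
      exact WithBot.coe_le_coe.2 (le_iInf₂ fun n hn => iInf₂_le n (h n hn))

/-- `m` is a finite family of functions whose superlevel sets cover `X` with order at most `n + 1`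
and refine the superlevel sets of the functions in `l`. -/
def IsSuperlevelRefinement {X : Type u} [TopologicalSpace X] (n : ℕ) (l m : Finset C(X, ℝ)) :
    Prop :=
  (∀ x, ∃ g ∈ m, x ∈ superlevel g) ∧ (∀ g ∈ m, ∃ f ∈ l, superlevel g ⊆ superlevel f) ∧
    coverOrder (superlevel '' (m : Set C(X, ℝ))) ≤ (n : ℕ∞) + 1

theorem CoveringDimLE.exists_isSuperlevelRefinement {X : Type u} [TopologicalSpace X]
    [CompactSpace X] [T2Space X] {n : ℕ} (hn : CoveringDimLE X n) {l : Finset C(X, ℝ)}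
    (hl : ∀ x, ∃ f ∈ l, x ∈ superlevel f) : ∃ m, IsSuperlevelRefinement n l m := by
  classical
  obtain ⟨Q, hQ, href, hord⟩ := hn (superlevel '' (l : Set C(X, ℝ)))
    ⟨l.finite_toSet.image _, by rintro _ ⟨f, -, rfl⟩; exact isOpen_superlevel f, by
      refine eq_univ_of_forall fun x => ?_
      obtain ⟨f, hf, hx⟩ := hl x
      exact ⟨_, mem_image_of_mem _ hf, hx⟩⟩
  obtain ⟨g, hg, hcov⟩ := exists_superlevel_shrinking dense_univ hQ
  refine ⟨hQ.1.toFinset.image g, fun x => ?_, fun f hf => ?_, ?_⟩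
  · obtain ⟨A, hA, hx⟩ := hcov x
    exact ⟨g A, by simpa using ⟨A, hA, rfl⟩, hx⟩
  · obtain ⟨A, hA, rfl⟩ : ∃ A ∈ Q, g A = f := by simpa using hf
    obtain ⟨_, ⟨f, hf, rfl⟩, hAf⟩ := href A hA
    exact ⟨f, hf, (hg A hA).2.trans hAf⟩
  · refine le_trans (le_of_eq ?_) ((coverOrder_image_le (s := fun A => superlevel (g A))
      fun A hA => (hg A hA).2).trans hord)
    rw [Finset.coe_image, Finite.coe_toFinset, image_image]

theorem IsStoneSpace.coveringDimLE_zero {X : Type u} [TopologicalSpace X] (hX : IsStoneSpace X) :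
    CoveringDimLE X 0 := by
  have := hX.compactSpace
  have := hX.t2Space
  have : TotallyDisconnectedSpace X := by
    have := hX.clopenBasis
    have : TotallySeparatedSpace X := totallySeparatedSpace_of_t0_of_basis_clopen this
    infer_instance
  rintro P ⟨-, hopen, hcov⟩
  have hU : IsOpenCover fun A : P => (⟨A.1, hopen _ A.2⟩ : Opens X) :=
    .of_sets (fun A => hopen _ A.2) (by rw [← sUnion_eq_iUnion, hcov])
  obtain ⟨n, W, hW, hWcov, hWd⟩ := hU.exists_finite_nonempty_disjoint_clopen_cover
  refine ⟨range fun j => (W j : Set X), ⟨finite_range _, ?_, ?_⟩, ?_, ?_⟩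
  · rintro _ ⟨j, rfl⟩
    exact (W j).isClopen.isOpen
  · rw [sUnion_range]
    exact univ_subset_iff.1 hWcov
  · rintro _ ⟨j, rfl⟩
    obtain ⟨A, hA⟩ := (hW j).2
    exact ⟨A.1, A.2, hA⟩
  · refine iSup_le fun x => ?_
    rw [Nat.cast_zero, zero_add, encard_le_one_iff]
    rintro _ _ ⟨⟨i, rfl⟩, hi⟩ ⟨⟨j, rfl⟩, hj⟩
    by_contra hne
    have hij : i ≠ j := fun h => hne (by rw [h])
    exact ((Clopens.coe_disjoint).2 (hWd hij)).notMem_of_mem_left hi hj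

theorem CoveringDimLE.isStoneSpace {X : Type u} [TopologicalSpace X] [CompactSpace X] [T2Space X]
    (h : CoveringDimLE X 0) : IsStoneSpace X := by
  refine ⟨‹_›, ‹_›, isTopologicalBasis_of_isOpen_of_nhds (fun A hA => hA.isOpen)
    fun x U hx hU => ?_⟩
  obtain ⟨Q, ⟨hfin, hopen, hcov⟩, href, hord⟩ := h {U, {x}ᶜ} ⟨by simp, by
    rintro A (rfl | rfl)
    exacts [hU, isOpen_compl_singleton], by
    refine eq_univ_of_forall fun y => ?_
    by_cases hy : y = x
    · exact ⟨U, by simp, hy ▸ hx⟩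
    · exact ⟨{x}ᶜ, by simp, hy⟩⟩
  -- A cover of order one consists of pairwise disjoint sets.
  have hdisj : ∀ y, ∀ A ∈ Q, ∀ B ∈ Q, y ∈ A → y ∈ B → A = B := by
    intro y A hA B hB hyA hyB
    have := (le_iSup (fun x : X => {A ∈ Q | x ∈ A}.encard) y).trans hord
    rw [Nat.cast_zero, zero_add, encard_le_one_iff] at this
    exact this A B ⟨hA, hyA⟩ ⟨hB, hyB⟩
  obtain ⟨A, hA, hxA⟩ := hcov.symm.subset (mem_univ x)
  refine ⟨A, ⟨?_, hopen A hA⟩, hxA, ?_⟩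
  · have : A = (⋃₀ (Q \ {A}))ᶜ := by
      ext y
      obtain ⟨B, hB, hyB⟩ := hcov.symm.subset (mem_univ y)
      refine ⟨fun hy => ?_, fun hy => ?_⟩
      · rintro ⟨C, ⟨hC, hCA⟩, hyC⟩
        exact hCA (hdisj y C hC A hA hyC hy)
      · by_contra hyA
        exact hy ⟨B, ⟨hB, fun h => hyA (h ▸ hyB)⟩, hyB⟩
    rw [this]
    exact (isOpen_sUnion fun C hC => hopen C hC.1).isClosed_compl
  · obtain ⟨B, hB, hAB⟩ := href A hA
    rcases hB with rfl | rfl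
    · exact hAB
    · exact (hAB hxA rfl).elim

/-! ### Factorization through a space of small weight -/

/-- A set `A` of functions on `Y` and a set `E` of self-maps of `Y`, both of cardinality at most `κ`,
give a `ℚ`-subalgebra of cardinality at most `κ` that contains `A`, is stable under precomposition
with `E`, and contains witnesses for the covering dimension of `Y`, as far as covers by superlevel
sets of its own members are concerned. Scalars are rational to keep the cardinality under control
when `κ` is below the continuum. -/
theorem exists_subalgebra_closed_under_refinement {Y : Type w} [TopologicalSpace Y]
    [CompactSpace Y] [T2Space Y] {κ : Cardinal.{w}} (hκ : ℵ₀ ≤ κ) {A : Set C(Y, ℝ)}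
    (hA : #A ≤ κ) {E : Set C(Y, Y)} (hE : #E ≤ κ) :
    ∃ F : Subalgebra ℚ C(Y, ℝ), A ⊆ F ∧ #F ≤ κ ∧ (∀ e ∈ E, ∀ f ∈ F, f.comp e ∈ F) ∧
      ∀ n, CoveringDimLE Y n → ∀ l : Finset C(Y, ℝ), (l : Set C(Y, ℝ)) ⊆ F →
        (∀ y, ∃ f ∈ l, y ∈ superlevel f) →
        ∃ m : Finset C(Y, ℝ), (m : Set C(Y, ℝ)) ⊆ F ∧ IsSuperlevelRefinement n l m := by
  classical
  have key : ∀ (l : Finset C(Y, ℝ)) (n : ℕ), ∃ m : Finset C(Y, ℝ), CoveringDimLE Y n →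
      (∀ y, ∃ f ∈ l, y ∈ superlevel f) → IsSuperlevelRefinement n l m := by
    intro l n
    by_cases h : CoveringDimLE Y n ∧ ∀ y, ∃ f ∈ l, y ∈ superlevel f
    · obtain ⟨m, hm⟩ := h.1.exists_isSuperlevelRefinement h.2
      exact ⟨m, fun _ _ => hm⟩
    · exact ⟨∅, fun h1 h2 => (h ⟨h1, h2⟩).elim⟩
  choose Φ hΦ using key
  -- A subset of `C(Y, ℝ)` closed under the operation `T` has all the required closure properties.
  let T (l : Finset C(Y, ℝ)) : Set C(Y, ℝ) :=
    (Algebra.adjoin ℚ (l : Set C(Y, ℝ)) : Set C(Y, ℝ)) ∪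
      (image2 (fun (e : C(Y, Y)) (f : C(Y, ℝ)) => f.comp e) E l ∪ ⋃ n, (Φ l n : Set C(Y, ℝ)))
  have hT (l) : #(T l) ≤ κ := by
    have hl : #(l : Set C(Y, ℝ)) ≤ ℵ₀ := (lt_aleph0_of_finite _).le
    refine (mk_union_le _ _).trans (add_le_of_le hκ ?_
      ((mk_union_le _ _).trans (add_le_of_le hκ ?_ ?_)))
    · have h := Algebra.lift_cardinalMk_adjoin_le ℚ (l : Set C(Y, ℝ))
      simp only [lift_uzero, Cardinal.mkRat, lift_aleph0] at h
      exact h.trans (max_le (max_le hκ (hl.trans hκ)) hκ)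
    · exact mk_image2_le.trans (mul_le_of_le hκ hE (hl.trans hκ))
    · exact (le_aleph0_iff_set_countable.2
        (countable_iUnion fun n => (Φ l n).countable_toSet)).trans hκ
  obtain ⟨F, hAF, hF, hcl⟩ := exists_superset_forall_finset_subset hκ hA T hT
  have hadj (l : Finset C(Y, ℝ)) (hl : (l : Set C(Y, ℝ)) ⊆ F) :
      (Algebra.adjoin ℚ (l : Set C(Y, ℝ)) : Set C(Y, ℝ)) ⊆ F :=
    subset_union_left.trans (hcl l hl)
  have hpair (f g : C(Y, ℝ)) (hf : f ∈ F) (hg : g ∈ F) :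
      (Algebra.adjoin ℚ {f, g} : Set C(Y, ℝ)) ⊆ F := by
    have := hadj {f, g} (by simp [insert_subset_iff, hf, hg])
    simpa using this
  refine ⟨{ carrier := F, mul_mem' := fun {f g} hf hg => ?_, add_mem' := fun {f g} hf hg => ?_,
            algebraMap_mem' := fun c => ?_ }, hAF, hF, fun e he f hf => ?_,
            fun n hn l hl hcov => ?_⟩
  · exact hpair f g hf hg (mul_mem (Algebra.subset_adjoin (by simp))
      (Algebra.subset_adjoin (by simp)))
  · exact hpair f g hf hg (add_mem (Algebra.subset_adjoin (by simp))
      (Algebra.subset_adjoin (by simp)))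
  · exact hadj ∅ (by simp) (algebraMap_mem _ c)
  · refine hcl {f} (by simpa using hf) (Or.inr (Or.inl ?_))
    exact ⟨e, he, f, by simp, rfl⟩
  · refine ⟨Φ l n, fun g hg => hcl l hl (Or.inr (Or.inr ?_)), hΦ l n hn hcov⟩
    exact mem_iUnion.2 ⟨n, hg⟩

/-- To bound the covering dimension of a compact Hausdorff space it suffices to refine the finite
covers by superlevel sets of functions from a dense set. -/
theorem CoveringDimLE.of_superlevel_refinements {K : Type u} [TopologicalSpace K]
    [CompactSpace K] [T2Space K] {n : ℕ} {G : Set C(K, ℝ)} (hG : Dense G)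
    (h : ∀ l : Finset C(K, ℝ), (l : Set C(K, ℝ)) ⊆ G → (∀ k, ∃ f ∈ l, k ∈ superlevel f) →
      ∃ m, IsSuperlevelRefinement n l m) : CoveringDimLE K n := by
  classical
  intro P hP
  obtain ⟨f, hf, hcov⟩ := exists_superlevel_shrinking hG hP
  obtain ⟨m, hm, href, hord⟩ := h (hP.1.toFinset.image f) (by
    intro g hg
    obtain ⟨A, hA, rfl⟩ : ∃ A ∈ P, f A = g := by simpa using hg
    exact (hf A hA).1) (fun k => by
    obtain ⟨A, hA, hk⟩ := hcov k
    exact ⟨f A, by simpa using ⟨A, hA, rfl⟩, hk⟩)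
  refine ⟨superlevel '' (m : Set C(K, ℝ)), ⟨m.finite_toSet.image _, ?_, ?_⟩, ?_, hord⟩
  · rintro _ ⟨g, -, rfl⟩
    exact isOpen_superlevel g
  · refine eq_univ_of_forall fun k => ?_
    obtain ⟨g, hg, hk⟩ := hm k
    exact ⟨_, mem_image_of_mem _ hg, hk⟩
  · rintro _ ⟨g, hg, rfl⟩
    obtain ⟨f', hf', hgf⟩ := href g hg
    obtain ⟨A, hA, rfl⟩ : ∃ A ∈ P, f A = f' := by simpa using hf'
    exact ⟨A, hA, hgf.trans (hf A hA).2⟩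

/-- Superlevel refinements descend along a surjection, as preimages under it preserve inclusions and
the order of a family. -/
theorem IsSuperlevelRefinement.of_comp {Y : Type w} [TopologicalSpace Y] {K : Type v}
    [TopologicalSpace K] [DecidableEq C(Y, ℝ)] {n : ℕ} {q : C(Y, K)} (hq : Function.Surjective q)
    {l m : Finset C(K, ℝ)}
    (h : IsSuperlevelRefinement n (l.image (·.comp q)) (m.image (·.comp q))) :
    IsSuperlevelRefinement n l m := by
  obtain ⟨hcov, href, hord⟩ := h
  refine ⟨fun k => ?_, fun g hg => ?_, ?_⟩
  · obtain ⟨y, rfl⟩ := hq k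
    obtain ⟨_, hg', hy⟩ := hcov y
    obtain ⟨g, hg, rfl⟩ := Finset.mem_image.1 hg'
    exact ⟨g, hg, hy⟩
  · obtain ⟨_, hf', hgf⟩ := href _ (Finset.mem_image_of_mem _ hg)
    obtain ⟨f, hf, rfl⟩ := Finset.mem_image.1 hf'
    refine ⟨f, hf, fun k hk => ?_⟩
    obtain ⟨y, rfl⟩ := hq k
    exact hgf hk
  · refine (coverOrder_le_preimage hq _).trans (le_trans (le_of_eq ?_) hord)
    rw [Finset.coe_image, image_image, image_image]
    rfl

/-- A Mardešić-type factorization theorem: a compact Hausdorff space `Y` has a Hausdorff quotient `K`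
of weight at most `κ` and of no larger dimension, through which the functions in `A` factor and to
which the self-maps in `E` descend. `K` is realized as the image of `Y` in a power `ℝ ^ F`. -/
theorem exists_quotient_topWeight_le {Y : Type w} [TopologicalSpace Y]
    [CompactSpace Y] [T2Space Y] {κ : Cardinal.{w}} (hκ : ℵ₀ ≤ κ) {A : Set C(Y, ℝ)}
    (hA : #A ≤ κ) {E : Set C(Y, Y)} (hE : #E ≤ κ) :
    ∃ (K : Type w) (_ : TopologicalSpace K) (_ : CompactSpace K) (_ : T2Space K) (q : C(Y, K)),
      Function.Surjective q ∧ (∀ f ∈ A, ∃ g : C(K, ℝ), g.comp q = f) ∧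
      (∀ e ∈ E, ∀ y z, q y = q z → q (e y) = q (e z)) ∧
      topWeight K ≤ κ ∧ ∀ n, CoveringDimLE Y n → CoveringDimLE K n := by
  classical
  obtain ⟨F, hAF, hF, hFE, hFdim⟩ := exists_subalgebra_closed_under_refinement hκ hA hE
  let Ψ : C(Y, F → ℝ) := ⟨fun y f => f.1 y, continuous_pi fun f => f.1.continuous⟩
  let q : C(Y, range Ψ) := ⟨rangeFactorization Ψ, Ψ.continuous.rangeFactorization⟩
  have hq : Function.Surjective q := rangeFactorization_surjective
  have hqeq (y z : Y) : q y = q z ↔ ∀ f ∈ F, f y = f z := by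
    rw [Subtype.ext_iff, funext_iff, Subtype.forall]
    rfl
  have hlift (f : C(Y, ℝ)) (hf : f ∈ F) : ∃ g : C(range Ψ, ℝ), g.comp q = f :=
    ⟨⟨fun k => k.1 ⟨f, hf⟩, (continuous_apply _).comp continuous_subtype_val⟩, rfl⟩
  have hcompact : CompactSpace (range Ψ) :=
    isCompact_iff_compactSpace.1 (isCompact_range Ψ.continuous)
  let G : Subalgebra ℚ C(range Ψ, ℝ) := F.comap (ContinuousMap.compRightAlgHom ℚ ℝ q)
  have hG (g : C(range Ψ, ℝ)) : g ∈ G ↔ g.comp q ∈ F := Iff.rfl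
  have hinj : Function.Injective fun g : C(range Ψ, ℝ) => g.comp q := fun g g' h => by
    ext k
    obtain ⟨y, rfl⟩ := hq k
    exact DFunLike.congr_fun h y
  have hdense : Dense (G : Set C(range Ψ, ℝ)) := by
    refine dense_of_separatesPoints_rat G fun k k' hkk' => ?_
    obtain ⟨y, rfl⟩ := hq k
    obtain ⟨z, rfl⟩ := hq k'
    refine (hqeq y z).2 fun f hf => ?_
    obtain ⟨g, rfl⟩ := hlift f hf
    exact hkk' g hf
  refine ⟨range Ψ, inferInstance, hcompact, inferInstance, q, hq, fun f hf => hlift f (hAF hf),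
    fun e he y z hyz => (hqeq _ _).2 fun f hf => (hqeq y z).1 hyz _ (hFE e he f hf), ?_,
    fun n hn => .of_superlevel_refinements hdense fun l hl hcov => ?_⟩
  · refine (topWeight_le_mk_of_dense hdense).trans (le_trans ?_ hF)
    exact mk_le_of_injective (f := fun g : G => (⟨g.1.comp q, g.2⟩ : F)) fun g g' h =>
      Subtype.ext (hinj (congrArg Subtype.val h))
  · obtain ⟨m, hm, hlm⟩ := hFdim n hn (l.image (·.comp q)) (by
      intro f hf
      obtain ⟨g, hg, rfl⟩ := Finset.mem_image.1 hf
      exact hl hg) (fun y => by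
      obtain ⟨f, hf, hy⟩ := hcov (q y)
      exact ⟨f.comp q, Finset.mem_image_of_mem _ hf, hy⟩)
    obtain ⟨m', rfl⟩ : ∃ m' : Finset C(range Ψ, ℝ), m'.image (·.comp q) = m := by
      have : (m : Set C(Y, ℝ)) ⊆ (·.comp q) '' (univ : Set C(range Ψ, ℝ)) := fun f hf => by
        obtain ⟨g, hg⟩ := hlift f (hm hf)
        exact ⟨g, trivial, hg⟩
      obtain ⟨m', -, hm'⟩ := Finset.subset_set_image_iff.1 this
      exact ⟨m', hm'⟩
    exact ⟨m', hlm.of_comp hq⟩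

/-! ### Functions that determine the topology of a subspace -/

/-- If `X` is a subspace of a compact Hausdorff space `Y`, then at most `w(X)²` functions on `Y` suffice
to separate the points of `X` from its closed subsets: one for each pair of basic open sets of `X`
that can be separated at all. -/
theorem exists_family_separating_points_from_closed {X : Type u} [TopologicalSpace X]
    {Y : Type w} [TopologicalSpace Y] [CompactSpace Y] [T2Space Y] {ν : X → Y}
    (hν : IsInducing ν) :
    ∃ A : Set C(Y, ℝ), lift.{u} #A ≤ lift.{w} (topWeight X * topWeight X) ∧
      ∀ (x : X) (U : Set X), IsOpen U → x ∈ U →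
        ∃ f ∈ A, f (ν x) < 1 ∧ ∀ z, f (ν z) < 1 → z ∈ U := by
  obtain ⟨B, hB, hc⟩ := exists_isTopologicalBasis_mk_eq_topWeight X
  -- Over pairs that no function separates the value of `f` is irrelevant.
  have key : ∀ p : B × B, ∃ f : C(Y, ℝ),
      (∃ g : C(Y, ℝ), (∀ x ∈ p.1.1, g (ν x) < 1) ∧ ∀ z, g (ν z) < 1 → z ∈ p.2.1) →
      (∀ x ∈ p.1.1, f (ν x) < 1) ∧ ∀ z, f (ν z) < 1 → z ∈ p.2.1 := by
    intro p
    by_cases h : ∃ g : C(Y, ℝ), (∀ x ∈ p.1.1, g (ν x) < 1) ∧ ∀ z, g (ν z) < 1 → z ∈ p.2.1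
    · exact ⟨h.choose, fun _ => h.choose_spec⟩
    · exact ⟨0, fun h' => (h h').elim⟩
  choose f hf using key
  refine ⟨range f, ?_, fun x U hU hx => ?_⟩
  · rw [← hc, mul_def]
    exact mk_range_le_lift
  · obtain ⟨V, hV, hxV, hVU⟩ := hB.exists_subset_of_mem_open hx hU
    obtain ⟨O, hO, hOV⟩ := hν.isOpen_iff.1 (hB.isOpen hV)
    have hxO : ν x ∈ O := by
      rw [← hOV] at hxV
      exact hxV
    obtain ⟨g, hg0, hg1, -⟩ := exists_continuous_zero_one_of_isClosed
      (isClosed_singleton (x := ν x)) hO.isClosed_compl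
      (disjoint_singleton_left.2 fun h => h hxO)
    obtain ⟨W, hW, hxW, hWg⟩ := hB.exists_subset_of_mem_open (a := x)
      (u := {z | g (ν z) < 1})
      (by simp [hg0 (mem_singleton (ν x))])
      (isOpen_lt (g.continuous.comp hν.continuous) continuous_const)
    have hfp := hf (⟨W, hW⟩, ⟨V, hV⟩) ⟨g, fun z hz => hWg hz, fun z hz => by
      change z ∈ V
      rw [← hOV]
      by_contra hzO
      have := hg1 (show ν z ∈ Oᶜ from hzO)
      simp only [Pi.one_apply] at this
      exact hz.ne this⟩
    exact ⟨_, mem_range_self _, hfp.1 x hxW, fun z hz => hVU (hfp.2 z hz)⟩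

/-! ### Descending the action -/

/-- A continuous action on a compact space descends to a continuous action on every Hausdorff quotient
by an invariant equivalence relation. -/
theorem exists_mulAction_of_surjective {S : Type v} [Monoid S] [TopologicalSpace S] {Y : Type w}
    [TopologicalSpace Y] [CompactSpace Y] [MulAction S Y] [ContinuousSMul S Y]
    {K : Type u} [TopologicalSpace K] [T2Space K] {q : Y → K} (hqc : Continuous q)
    (hq : Function.Surjective q) (hS : ∀ (s : S) (y z : Y), q y = q z → q (s • y) = q (s • z)) :
    ∃ _ : MulAction S K, ContinuousSMul S K ∧ ∀ (s : S) (y : Y), q (s • y) = s • q y := by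
  let _ : SMul S K := ⟨fun s k => q (s • Function.surjInv hq k)⟩
  have hsmul (s : S) (y : Y) : q (s • y) = s • q y :=
    hS s _ _ (Function.surjInv_eq hq (q y)).symm
  refine ⟨hq.mulAction q hsmul, ⟨?_⟩, hsmul⟩
  -- The map `id × q` is proper, hence a quotient map, whatever the space `S` is.
  have hquot : IsQuotientMap (Prod.map id q : S × Y → S × K) :=
    (isProperMap_id.prodMap hqc.isProperMap).isClosedMap.isQuotientMap
      (continuous_id.prodMap hqc) (Function.surjective_id.prodMap hq)
  refine hquot.continuous_iff.2 ?_
  refine (hqc.comp (continuous_smul (M := S) (X := Y))).congr fun p => ?_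
  exact hsmul p.1 p.2

/-! ### The factored compactification -/

/-- The case of an infinite `X`. For the action to descend to the quotient it is enough that the
elements of a dense subset of `S` descend, and such a subset can be found with at most `w(S)`
elements. -/
theorem IsProperSCompactification.exists_factorization {S : Type v} [Monoid S]
    [TopologicalSpace S] {X : Type u} [TopologicalSpace X] [MulAction S X] [Infinite X]
    {Y : Type w} [TopologicalSpace Y] [MulAction S Y]
    {ν : X → Y} (hν : IsProperSCompactification S ν) :
    ∃ (K : Type w) (_ : TopologicalSpace K) (_ : MulAction S K) (q : Y → K),
      Continuous q ∧ (∀ (s : S) (y : Y), q (s • y) = s • q y) ∧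
      IsProperSCompactification S (q ∘ ν) ∧
      lift.{max u v} (topWeight K) ≤ lift.{max v w} (topWeight X) * lift.{max u w} (topWeight S) ∧
      ∀ n, CoveringDimLE Y n → CoveringDimLE K n := by
  have := hν.compactSpace
  have := hν.t2Space
  have := hν.continuousSMul
  have : T2Space X := hν.isEmbedding.t2Space
  have hX := aleph0_le_topWeight X
  obtain ⟨A, hAc, hA⟩ := exists_family_separating_points_from_closed hν.isEmbedding.isInducing
  rw [mul_eq_self hX] at hAc
  obtain ⟨D, hD, hDc⟩ := exists_dense_mk_le_topWeight S
  let act (s : S) : C(Y, Y) := ⟨fun y => s • y, continuous_const_smul s⟩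
  obtain ⟨K, _, _, _, q, hq, hqA, hqE, hKw, hKdim⟩ :=
    exists_quotient_topWeight_le (κ := max ℵ₀ (max #A #(act '' D))) (le_max_left _ _)
      ((le_max_left _ _).trans (le_max_right _ _)) ((le_max_right _ _).trans (le_max_right _ _))
  -- The relation holds on the dense set `D`, and it is closed in `s` because `K` is Hausdorff.
  have hqS (s : S) (y z : Y) (hyz : q y = q z) : q (s • y) = q (s • z) := by
    have hcl : IsClosed {s : S | q (s • y) = q (s • z)} :=
      isClosed_eq (q.continuous.comp (continuous_id.smul continuous_const))
        (q.continuous.comp (continuous_id.smul continuous_const))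
    exact hcl.closure_subset_iff.2 (fun d hd => hqE _ (mem_image_of_mem act hd) y z hyz) (hD s)
  obtain ⟨_, hcont, hequiv⟩ := exists_mulAction_of_surjective q.continuous hq hqS
  have hind : IsInducing (q ∘ ν) := by
    refine isInducing_iff_nhds.2 fun x => le_antisymm
      (q.continuous.comp hν.isEmbedding.continuous).continuousAt.le_comap fun U hU => ?_
    obtain ⟨V, hVU, hV, hxV⟩ := mem_nhds_iff.1 hU
    obtain ⟨f, hf, hfx, hfV⟩ := hA x V hV hxV
    obtain ⟨g, rfl⟩ := hqA f hf
    exact ⟨{k | g k < 1}, (isOpen_lt g.continuous continuous_const).mem_nhds hfx,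
      fun z hz => hVU (hfV z hz)⟩
  refine ⟨K, _, _, q, q.continuous, hequiv, ⟨‹_›, ‹_›, hcont, fun s x => ?_,
    hq.denseRange.comp hν.denseRange q.continuous, hind.isEmbedding⟩, ?_, hKdim⟩
  · rw [Function.comp_apply, hν.map_smul, hequiv, Function.comp_apply]
  · have hS1 : 1 ≤ lift.{max u w} (topWeight S) := by
      rw [Cardinal.one_le_iff_ne_zero, Ne, lift_eq_zero]
      exact topWeight_ne_zero S
    have hXτ : lift.{max v w} (topWeight X) ≤
        lift.{max v w} (topWeight X) * lift.{max u w} (topWeight S) :=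
      le_mul_of_one_le_right' hS1
    have hSτ : lift.{max u w} (topWeight S) ≤
        lift.{max v w} (topWeight X) * lift.{max u w} (topWeight S) :=
      le_mul_of_one_le_left' (one_le_aleph0.trans (aleph0_le_lift.2 hX))
    refine (lift_le.2 hKw).trans ?_
    rw [lift_max, lift_max, lift_aleph0]
    refine max_le ((aleph0_le_lift.2 hX).trans hXτ) (max_le (le_trans ?_ hXτ) (le_trans ?_ hSτ))
    · have := lift_le.{v}.2 hAc
      simpa using this
    · have h := lift_le.{u}.2 ((mk_image_le_lift (f := act) (s := D)).trans (lift_le.2 hDc))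
      simpa using h

theorem IsProperSCompactification.surjective_of_finite {S : Type v} [Monoid S]
    [TopologicalSpace S] {X : Type u} [TopologicalSpace X] [MulAction S X] [Finite X]
    {Y : Type w} [TopologicalSpace Y] [MulAction S Y]
    {ν : X → Y} (hν : IsProperSCompactification S ν) : Function.Surjective ν := by
  have := hν.t2Space
  rw [← range_eq_univ, ← hν.denseRange.closure_range, (finite_range ν).isClosed.closure_eq]

theorem theorem6 {S : Type v} [Monoid S] [TopologicalSpace S] [ContinuousMul S]
    {X : Type u} [TopologicalSpace X] [MulAction S X] [ContinuousSMul S X]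
    {Y : Type w} [TopologicalSpace Y] [MulAction S Y]
    (ν : X → Y) (hν : IsProperSCompactification S ν) :
    ∃ (K : Type w) (_ : TopologicalSpace K) (_ : MulAction S K) (σ : X → K),
      IsProperSCompactification S σ ∧
      (∃ q : Y → K, Continuous q ∧ (∀ (s : S) (y : Y), q (s • y) = s • q y) ∧ σ = q ∘ ν) ∧
      Cardinal.lift.{w} (topWeight X) ≤ Cardinal.lift.{u} (topWeight K) ∧
      Cardinal.lift.{max u v} (topWeight K) ≤
        Cardinal.lift.{max v w} (topWeight X) * Cardinal.lift.{max u w} (topWeight S) ∧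
      coveringDim K ≤ coveringDim Y ∧
      (coveringDim Y = 0 → coveringDim K = 0) ∧
      (IsStoneSpace Y → IsStoneSpace K) ∧
      (Cardinal.lift.{u} (topWeight S) ≤ Cardinal.lift.{v} (topWeight X) →
        Cardinal.lift.{w} (topWeight X) = Cardinal.lift.{u} (topWeight K)) ∧
      (SecondCountableTopology S →
        Cardinal.lift.{w} (topWeight X) = Cardinal.lift.{u} (topWeight K)) := by
  rcases finite_or_infinite X with hX | hX
  · -- A finite `X` fills `Y`. Its weight may be finite, so the general construction, whose
    -- weight is bounded only by an infinite cardinal, is replaced by `K = Y`.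
    have hle := lift_topWeight_le_of_isInducing hν.isEmbedding.isInducing
    have heq : lift.{w} (topWeight X) = lift.{u} (topWeight Y) :=
      hle.antisymm (lift_topWeight_le_of_isInducing
        (hν.isEmbedding.toHomeomorphOfSurjective hν.surjective_of_finite).symm.isInducing)
    refine ⟨Y, _, _, ν, hν, ⟨id, continuous_id, fun _ _ => rfl, rfl⟩, hle, ?_, le_rfl, id, id,
      fun _ => heq, fun _ => heq⟩
    have heq' := congrArg lift.{v} heq
    simp only [lift_lift] at heq'
    have hS1 : 1 ≤ lift.{max u w} (topWeight S) := by
      rw [Cardinal.one_le_iff_ne_zero, Ne, lift_eq_zero]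
      exact topWeight_ne_zero S
    calc lift.{max u v} (topWeight Y) = lift.{max v w} (topWeight X) := by
          simpa using heq'.symm
      _ ≤ _ := le_mul_of_one_le_right' hS1
  · obtain ⟨K, _, _, q, hqc, hequiv, hσ, hKw, hdim⟩ := hν.exists_factorization
    have := hν.t2Space
    have : T2Space X := hν.isEmbedding.t2Space
    have hXω := aleph0_le_topWeight X
    have := hσ.compactSpace
    have := hσ.t2Space
    have hle := lift_topWeight_le_of_isInducing hσ.isEmbedding.isInducing
    have : Nonempty Y := ⟨ν (Classical.arbitrary X)⟩
    have : Nonempty K := ⟨q (Classical.arbitrary Y)⟩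
    have hdimle : coveringDim K ≤ coveringDim Y :=
      coveringDim_le_of_forall (fun h => (not_isEmpty_of_nonempty Y h).elim) hdim
    have heq (h : lift.{u} (topWeight S) ≤ lift.{v} (topWeight X)) :
        lift.{w} (topWeight X) = lift.{u} (topWeight K) := by
      refine hle.antisymm ?_
      have h' : lift.{max u w} (topWeight S) ≤ lift.{max v w} (topWeight X) := by
        simpa using lift_le.{w}.2 h
      have hKX := hKw.trans (mul_le_of_le (aleph0_le_lift.2 hXω) le_rfl h')
      rw [← lift_le.{v}]
      simpa using hKX
    refine ⟨K, _, _, q ∘ ν, hσ, ⟨q, hqc, hequiv, rfl⟩, hle, hKw, hdimle, fun h => ?_,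
      fun h => (hdim 0 h.coveringDimLE_zero).isStoneSpace, heq, fun _ => heq ?_⟩
    · refine le_antisymm (h ▸ hdimle) ?_
      simp [coveringDim]
    · exact (lift_le_aleph0.2 (topWeight_le_aleph0 S)).trans (aleph0_le_lift.2 hXω)
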